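/- Let $\mathcal B$ be a von Neumann algebra acting on a Hilbert space $\mathcal H$ and let $\Omega$ be a set. \emph{Modules.} A Hilbert $\mathcal B$-$\mathcal B$-bimodule is a Hilbert right $\mathcal B$-module $E$ (a complete right $\mathcal B$-module with $\mathcal B$-valued inner product $\langle\cdot,\cdot\rangle$, linear in the second variable, and norm $\|x\|=\|\langle x,x\rangle\|^{1/2}$) together with a unital $*$-homomorphism from $\mathcal B$ into the adjointable operators on $E$, written $x\mapsto bx$. For $x\in E$ let $L_x:\mathcal H\to E\otimes\mathcal H$, $L_xh=x\otimes h$, where $E\otimes\mathcal H$ is the interior tensor product, i.e. the Hilbert space with $\langle x\otimes h,y\otimes k\rangle=\langle h,\langle x,y\rangle k\rangle$. $E$ is a von Neumann $\mathcal B$-module if $\{L_x:x\in E\}$ is closed in $\mathcal B(\mathcal H,E\otimes\mathcal H)$ in the strong operator topology; a Hilbert $\mathcal B$-$\mathcal B$-bimodule with this property is called a von Neumann $\mathcal B$-$\mathcal B$-module (no normality of the left action is required). \emph{Kernels.} A CPD-kernel over $\Omega$ from $\mathcal B$ to $\mathcal B$ is a family $\mathfrak K=(\mathfrak K^{\sigma,\sigma'})_{\sigma,\sigma'\in\Omega}$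 of bounded linear maps $\mathcal B\to\mathcal B$ with $\sum_{i,j}c_i^*\,\mathfrak K^{\sigma_i,\sigma_j}(b_i^*b_j)\,c_j\ge 0$ for all finite choices of $\sigma_i\in\Omega$ and $b_i,c_i\in\mathcal B$. For a Hilbert $\mathcal B$-$\mathcal B$-bimodule $E$ let $\mathcal S(E,\mathfrak K)$ be the set of all maps $\mathfrak i:\Omega\to E$ with $\mathfrak K^{\sigma,\sigma'}(b)=\langle\mathfrak i(\sigma),b\,\mathfrak i(\sigma')\rangle$ for all $\sigma,\sigma'\in\Omega$ and $b\in\mathcal B$. A Kolmogorov decomposition $(\mathcal F,\mathfrak i)$ of $\mathfrak K$ consists of a von Neumann $\mathcal B$-$\mathcal B$-module $\mathcal F$ and a map $\mathfrak i\in\mathcal S(\mathcal F,\mathfrak K)$ (it need not be minimal). \emph{Bures distance.} For CPD-kernels $\mathfrak K_1,\mathfrak K_2$ put $$\beta(\mathfrak K_1,\mathfrak K_2)=\inf\{\|\mathfrak i_1(\sigma)-\mathfrak i_2(\sigma)\|:\ E\text{ a Hilbert }\mathcal B\text{-}\mathcal B\text{-bimodule},\ \mathfrak i_1\in\mathcal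 S(E,\mathfrak K_1),\ \mathfrak i_2\in\mathcal S(E,\mathfrak K_2),\ \sigma\in\Omega\},$$ with $\inf\emptyset=\infty$. Let $id_{\mathcal B}$ also denote the kernel with $id_{\mathcal B}^{\sigma,\sigma'}=id_{\mathcal B}$ for all $\sigma,\sigma'\in\Omega$. \textbf{Theorem.} Let $\mathfrak K$ be a CPD-kernel over $\Omega$ from $\mathcal B$ to $\mathcal B$, let $(\mathcal F,\mathfrak i)$ be a Kolmogorov decomposition of $\mathfrak K$, and suppose that $\beta(\mathfrak K,id_{\mathcal B})<1$. Then there is a von Neumann $\mathcal B$-$\mathcal B$-module $\mathcal F'$ such that $\mathcal F$ is isomorphic to $\mathcal B\oplus\mathcal F'$, i.e. there is a bijective linear map $\mathcal F\to\mathcal B\oplus\mathcal F'$ that respects the left and the right actions of $\mathcal B$ and the inner products, where $\mathcal B\oplus\mathcal F'$ carries the componentwise actions and the inner product $\langle(a,x),(b,y)\rangle=a^*b+\langle x,y\rangle$. -/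

import Mathlib

open scoped InnerProductSpace TensorProduct ENNReal

universe u w v t

namespace VNModule

variable {H : Type u} [NormedAddCommGroup H] [InnerProductSpace ℂ H] [CompleteSpace H]

/-- The elements of a von Neumann algebra `M` acting on `H`, as a type. -/
abbrev Elem (M : VonNeumannAlgebra H) : Type u := ↥M.toStarSubalgebra

theorem isClosed_carrier (M : VonNeumannAlgebra H) :
    IsClosed (M.toStarSubalgebra : Set (H →L[ℂ] H)) := by
  rw [VonNeumannAlgebra.coe_toStarSubalgebra, ← M.centralizer_centralizer]
  exact Set.isClosed_centralizer _

noncomputable instance instCStarAlgebraElem (M : VonNeumannAlgebra H) : CStarAlgebra (Elem M) :=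
  @StarSubalgebra.cstarAlgebra _ _ _ _ _ _ _ M.toStarSubalgebra (isClosed_carrier M)

/-- A Hilbert (right) module over the von Neumann algebra `M`. The right action of `b` on `x`
is `MulOpposite.op b • x`; the inner product is linear in the second variable. -/
structure HilbertModule (M : VonNeumannAlgebra H) where
  carrier : Type v
  [instNormed : NormedAddCommGroup carrier]
  [instSpace : NormedSpace ℂ carrier]
  [instComplete : CompleteSpace carrier]
  [instRight : Module (Elem M)ᵐᵒᵖ carrier]
  [instTower : IsScalarTower ℂ (Elem M)ᵐᵒᵖ carrier]
  inner : carrier → carrier → Elem M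
  inner_add_right : ∀ x y z, inner x (y + z) = inner x y + inner x z
  inner_smul_right : ∀ x y (c : ℂ), inner x (c • y) = c • inner x y
  inner_mul_right : ∀ x y (b : Elem M), inner x (MulOpposite.op b • y) = inner x y * b
  star_inner : ∀ x y, star (inner x y) = inner y x
  inner_self_nonneg : ∀ x, (inner x x : H →L[ℂ] H).IsPositive
  inner_self_eq_zero : ∀ x, inner x x = 0 → x = 0
  norm_sq_eq : ∀ x, ‖x‖ ^ 2 = ‖inner x x‖

attribute [instance] HilbertModule.instNormed HilbertModule.instSpace HilbertModule.instComplete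
  HilbertModule.instRight HilbertModule.instTower

namespace HilbertModule

variable {M : VonNeumannAlgebra H} (E : HilbertModule.{u, v} M)

theorem inner_add_left (x y z : E.carrier) : E.inner (x + y) z = E.inner x z + E.inner y z := by
  rw [← E.star_inner, E.inner_add_right, star_add, E.star_inner, E.star_inner]

theorem inner_smul_left (x y : E.carrier) (c : ℂ) :
    E.inner (c • x) y = star c • E.inner x y := by
  rw [← E.star_inner, E.inner_smul_right, star_smul, E.star_inner]

theorem inner_mul_left (x y : E.carrier) (b : Elem M) :
    E.inner (MulOpposite.op b • x) y = star b * E.inner x y := by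
  rw [← E.star_inner, E.inner_mul_right, star_mul, E.star_inner]

theorem inner_zero_right (x : E.carrier) : E.inner x 0 = 0 := by
  simpa using E.inner_smul_right x 0 0

theorem inner_zero_left (x : E.carrier) : E.inner 0 x = 0 := by
  simpa using E.inner_smul_left 0 x 0

theorem inner_sum_right {ι : Type*} (s : Finset ι) (x : E.carrier) (f : ι → E.carrier) :
    E.inner x (∑ i ∈ s, f i) = ∑ i ∈ s, E.inner x (f i) :=
  map_sum (AddMonoidHom.mk' (E.inner x) (E.inner_add_right x)) f s

theorem inner_sum_left {ι : Type*} (s : Finset ι) (x : E.carrier) (f : ι → E.carrier) :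
    E.inner (∑ i ∈ s, f i) x = ∑ i ∈ s, E.inner (f i) x :=
  map_sum (AddMonoidHom.mk' (fun y => E.inner y x) (fun y z => E.inner_add_left y z x)) f s

end HilbertModule

/-- A self-adjoint `T` in a C*-algebra is positive as soon as every `X ≥ 0` with `X T X ≤ 0`
in the form below vanishes. -/
theorem nonneg_of_forall_compression {C : Type*} [CStarAlgebra C] (T : C) (hT : IsSelfAdjoint T)
    (h : ∀ X S : C, IsSelfAdjoint X → X = star S * S →
      X * T * X = -(star (S * X) * (S * X)) → S * X = 0) :
    ∃ R : C, T = star R * R := by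
  let _ : PartialOrder C := CStarAlgebra.spectralOrder C
  have _ : StarOrderedRing C := CStarAlgebra.spectralOrderedRing C
  have hX0 : 0 ≤ T⁻ := CFC.negPart_nonneg T
  have hXsa : IsSelfAdjoint T⁻ := IsSelfAdjoint.of_nonneg hX0
  obtain ⟨S, hS⟩ := CStarAlgebra.nonneg_iff_eq_star_mul_self.1 hX0
  have hXT : T⁻ * T * T⁻ = -(star (S * T⁻) * (S * T⁻)) := by
    have h1 : T⁻ * T = -(T⁻ * T⁻) := by
      conv_lhs => enter [2]; rw [← CFC.posPart_sub_negPart T hT]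
      rw [mul_sub, CFC.negPart_mul_posPart, zero_sub]
    rw [h1, star_mul, hXsa.star_eq, neg_mul]
    congr 1
    calc T⁻ * T⁻ * T⁻ = T⁻ * (star S * S) * T⁻ := by rw [← hS]
      _ = _ := by simp only [mul_assoc]
  have hY := h T⁻ S hXsa hS hXT
  have hXX : T⁻ * T⁻ = 0 := by
    calc T⁻ * T⁻ = star S * S * T⁻ := by rw [← hS]
      _ = star S * (S * T⁻) := mul_assoc ..
      _ = 0 := by rw [hY, mul_zero]
  have hXz : T⁻ = 0 := by
    have : star T⁻ * T⁻ = 0 := by rw [hXsa.star_eq, hXX]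
    exact (CStarRing.star_mul_self_eq_zero_iff T⁻).1 this
  have hTpos : 0 ≤ T := by
    rw [← CFC.posPart_sub_negPart T hT, hXz, sub_zero]
    exact CFC.posPart_nonneg T
  exact CStarAlgebra.nonneg_iff_eq_star_mul_self.1 hTpos

/-- A matrix `(a i j)` over `M` such that all `∑ (b i)* (a i j) (b j)` are positive is positive as
an operator on `Hⁿ`. -/
theorem gram_nonneg {M : VonNeumannAlgebra H} {n : Type*} [Fintype n] (a : n → n → Elem M)
    (hs : ∀ i j, star (a i j) = a j i)
    (hp : ∀ b : n → Elem M,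
      ((∑ i, ∑ j, star (b i) * a i j * b j : Elem M) : H →L[ℂ] H).IsPositive)
    (h : n → H) : 0 ≤ (∑ i, ∑ j, ⟪h i, (a i j : H →L[ℂ] H) (h j)⟫_ℂ).re := by
  classical
  let _ : PartialOrder (Elem M) := CStarAlgebra.spectralOrder _
  have _ : StarOrderedRing (Elem M) := CStarAlgebra.spectralOrderedRing _
  let T : CStarMatrix n n (Elem M) := CStarMatrix.ofMatrix (fun i j => a i j)
  have hT : ∀ i j, T i j = a i j := fun i j => rfl
  have hTsa : IsSelfAdjoint T := by
    ext i j
    rw [CStarMatrix.star_apply, hT, hT, hs]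
  -- diagonal entries of `star Y * Y`, evaluated at a vector
  have hdiag : ∀ (Y : CStarMatrix n n (Elem M)) (l : n) (k : H),
      ⟪k, (((star Y * Y) l l : Elem M) : H →L[ℂ] H) k⟫_ℂ
        = ∑ i, ((‖(Y i l : H →L[ℂ] H) k‖ ^ 2 : ℝ) : ℂ) := by
    intro Y l k
    rw [CStarMatrix.mul_apply]
    simp only [CStarMatrix.star_apply, AddSubmonoidClass.coe_finsetSum, sum_apply,
      inner_sum]
    refine Finset.sum_congr rfl fun i _ => ?_
    change ⟪k, (star (Y i l : H →L[ℂ] H)) ((Y i l : H →L[ℂ] H) k)⟫_ℂ = _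
    rw [ContinuousLinearMap.star_eq_adjoint, ContinuousLinearMap.adjoint_inner_right,
      inner_self_eq_norm_sq_to_K]
    norm_cast
  obtain ⟨R, hR⟩ := nonneg_of_forall_compression T hTsa <| by
    intro X S hXsa hS hXT
    refine CStarMatrix.ext fun i l => ?_
    rw [CStarMatrix.zero_apply]
    refine Subtype.ext ?_
    change ((S * X) i l : H →L[ℂ] H) = 0
    refine ContinuousLinearMap.ext fun k => ?_
    have h1 := (hp (fun i => X i l)).re_inner_nonneg_right k
    have h2 : (∑ i, ∑ j, star (X i l) * a i j * X j l) = (X * T * X) l l := by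
      simp only [CStarMatrix.mul_apply, Finset.sum_mul]
      rw [Finset.sum_comm]
      refine Finset.sum_congr rfl fun j _ => Finset.sum_congr rfl fun i _ => ?_
      rw [hT, ← CStarMatrix.star_apply, hXsa.star_eq]
    have h3 : (((X * T * X) l l : Elem M) : H →L[ℂ] H)
        = -(((star (S * X) * (S * X)) l l : Elem M) : H →L[ℂ] H) := by
      rw [hXT]; rfl
    rw [h2, h3, neg_apply, inner_neg_right, hdiag] at h1
    have h4 : ∑ i, ‖((S * X) i l : H →L[ℂ] H) k‖ ^ 2 ≤ 0 := by
      have : RCLike.re (-∑ i, ((‖((S * X) i l : H →L[ℂ] H) k‖ ^ 2 : ℝ) : ℂ))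
          = - ∑ i, ‖((S * X) i l : H →L[ℂ] H) k‖ ^ 2 := by
        rw [← Complex.ofReal_sum, ← Complex.ofReal_neg]; exact Complex.ofReal_re _
      rw [this] at h1
      linarith
    have h5 := (Finset.sum_eq_zero_iff_of_nonneg (fun i _ => by positivity)).1
      (le_antisymm h4 (Finset.sum_nonneg fun i _ => by positivity)) i (Finset.mem_univ _)
    simpa using h5
  have key : ∑ i, ∑ j, ⟪h i, (a i j : H →L[ℂ] H) (h j)⟫_ℂ
      = ∑ k, ⟪∑ i, (R k i : H →L[ℂ] H) (h i), ∑ j, (R k j : H →L[ℂ] H) (h j)⟫_ℂ := by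
    have e1 : ∀ i j, ⟪h i, (a i j : H →L[ℂ] H) (h j)⟫_ℂ
        = ∑ k, ⟪(R k i : H →L[ℂ] H) (h i), (R k j : H →L[ℂ] H) (h j)⟫_ℂ := by
      intro i j
      rw [← hT, hR, CStarMatrix.mul_apply]
      simp only [CStarMatrix.star_apply, AddSubmonoidClass.coe_finsetSum,
        sum_apply, inner_sum]
      refine Finset.sum_congr rfl fun k _ => ?_
      change ⟪h i, (star (R k i : H →L[ℂ] H)) ((R k j : H →L[ℂ] H) (h j))⟫_ℂ = _
      rw [ContinuousLinearMap.star_eq_adjoint, ContinuousLinearMap.adjoint_inner_right]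
    simp only [e1, inner_sum, sum_inner]
    calc _ = ∑ i, ∑ k, ∑ j, ⟪(R k i : H →L[ℂ] H) (h i), (R k j : H →L[ℂ] H) (h j)⟫_ℂ :=
          Finset.sum_congr rfl fun i _ => Finset.sum_comm
      _ = ∑ k, ∑ i, ∑ j, ⟪(R k i : H →L[ℂ] H) (h i), (R k j : H →L[ℂ] H) (h j)⟫_ℂ :=
          Finset.sum_comm
      _ = _ := Finset.sum_congr rfl fun k _ => Finset.sum_comm
  rw [key, Complex.re_sum]
  exact Finset.sum_nonneg fun k _ => inner_self_nonneg (𝕜 := ℂ)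

namespace HilbertModule

variable {M : VonNeumannAlgebra H} (E : HilbertModule.{u, v} M)

/-- The algebraic tensor product of `E` and `H`, to be endowed with the semi-inner product
`⟪x ⊗ h, y ⊗ k⟫ = ⟪h, ⟨x, y⟩ k⟫`. -/
def PreTensor : Type (max u v) := E.carrier ⊗[ℂ] H

noncomputable instance : AddCommGroup E.PreTensor := inferInstanceAs (AddCommGroup (E.carrier ⊗[ℂ] H))
noncomputable instance : Module ℂ E.PreTensor := inferInstanceAs (Module ℂ (E.carrier ⊗[ℂ] H))

/-- The elementary tensor `x ⊗ h`. -/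
noncomputable def preTmul (x : E.carrier) (h : H) : E.PreTensor := x ⊗ₜ[ℂ] h

/-- For fixed `x` and `h`, the linear functional `y ⊗ k ↦ ⟪h, ⟨x, y⟩ k⟫`. -/
noncomputable def tensorFunctional (x : E.carrier) (h : H) : E.carrier ⊗[ℂ] H →ₗ[ℂ] ℂ :=
  TensorProduct.lift <| LinearMap.mk₂ ℂ (fun y k => ⟪h, (E.inner x y : H →L[ℂ] H) k⟫_ℂ)
    (fun y y' k => by simp [E.inner_add_right])
    (fun c y k => by
      rw [E.inner_smul_right]
      change ⟪h, (c • (E.inner x y : H →L[ℂ] H)) k⟫_ℂ = _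
      simp)
    (fun y k k' => by simp)
    (fun c y k => by simp)

/-- The sesquilinear form on the algebraic tensor product determined by
`⟪x ⊗ h, y ⊗ k⟫ = ⟪h, ⟨x, y⟩ k⟫`. -/
noncomputable def tensorForm : E.carrier ⊗[ℂ] H →ₗ⋆[ℂ] E.carrier ⊗[ℂ] H →ₗ[ℂ] ℂ :=
  TensorProduct.lift <| LinearMap.mk₂'ₛₗ (starRingEnd ℂ) (starRingEnd ℂ) E.tensorFunctional
    (fun x x' h => by
      refine TensorProduct.ext' fun y k => ?_
      simp [tensorFunctional, E.inner_add_left])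
    (fun c x h => by
      refine TensorProduct.ext' fun y k => ?_
      simp only [tensorFunctional, TensorProduct.lift.tmul, LinearMap.mk₂_apply,
        LinearMap.smul_apply, E.inner_smul_left]
      change ⟪h, (star c • (E.inner x y : H →L[ℂ] H)) k⟫_ℂ = _
      simp [mul_comm])
    (fun x h h' => by
      refine TensorProduct.ext' fun y k => ?_
      simp [tensorFunctional])
    (fun c x h => by
      refine TensorProduct.ext' fun y k => ?_
      simp [tensorFunctional, mul_comm])

theorem tensorForm_tmul (x y : E.carrier) (h k : H) :
    E.tensorForm (x ⊗ₜ h) (y ⊗ₜ k) = ⟪h, (E.inner x y : H →L[ℂ] H) k⟫_ℂ := rfl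

theorem tensorForm_conj_symm (s r : E.carrier ⊗[ℂ] H) :
    (starRingEnd ℂ) (E.tensorForm r s) = E.tensorForm s r := by
  induction s using TensorProduct.induction_on with
  | zero => simp
  | add s s' hs hs' => simp [hs, hs']
  | tmul x h =>
    induction r using TensorProduct.induction_on with
    | zero => simp
    | add r r' hr hr' => simp [hr, hr']
    | tmul y k =>
      rw [tensorForm_tmul, tensorForm_tmul, ← E.star_inner x y]
      change (starRingEnd ℂ) ⟪k, (star (E.inner x y : H →L[ℂ] H)) h⟫_ℂ = _
      rw [ContinuousLinearMap.star_eq_adjoint, ContinuousLinearMap.adjoint_inner_right,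
        inner_conj_symm]

theorem tensorForm_re_nonneg (s : E.carrier ⊗[ℂ] H) : 0 ≤ (E.tensorForm s s).re := by
  obtain ⟨m, x, h, rfl⟩ : ∃ (m : ℕ) (x : Fin m → E.carrier) (h : Fin m → H),
      s = ∑ i, x i ⊗ₜ[ℂ] h i := by
    induction s using TensorProduct.induction_on with
    | zero => exact ⟨0, Fin.elim0, Fin.elim0, by simp⟩
    | tmul x h => exact ⟨1, fun _ => x, fun _ => h, by simp⟩
    | add s r hs hr =>
      obtain ⟨m, x, h, rfl⟩ := hs
      obtain ⟨m', x', h', rfl⟩ := hr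
      exact ⟨m + m', Fin.append x x', Fin.append h h', by simp [Fin.sum_univ_add]⟩
  have key := gram_nonneg (fun i j => E.inner (x i) (x j)) (fun i j => E.star_inner _ _)
    (fun b => by
      have : (∑ i, ∑ j, star (b i) * E.inner (x i) (x j) * b j)
          = E.inner (∑ i, MulOpposite.op (b i) • x i) (∑ i, MulOpposite.op (b i) • x i) := by
        simp only [E.inner_sum_left, E.inner_sum_right, E.inner_mul_right, E.inner_mul_left]
      rw [this]
      exact E.inner_self_nonneg _) h
  have e : E.tensorForm (∑ i, x i ⊗ₜ[ℂ] h i) (∑ i, x i ⊗ₜ[ℂ] h i)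
      = ∑ i, ∑ j, ⟪h i, (E.inner (x i) (x j) : H →L[ℂ] H) (h j)⟫_ℂ := by
    simp only [map_sum, LinearMap.sum_apply, tensorForm_tmul]
    exact Finset.sum_comm
  rw [e]
  exact key

noncomputable abbrev preTensorCore : PreInnerProductSpace.Core ℂ E.PreTensor where
  inner s r := E.tensorForm s r
  conj_inner_symm s r := E.tensorForm_conj_symm s r
  re_inner_nonneg s := E.tensorForm_re_nonneg s
  add_left s s' r := DFunLike.congr_fun (E.tensorForm.map_add s s') r
  smul_left s r c := DFunLike.congr_fun (E.tensorForm.map_smulₛₗ c s) r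

noncomputable instance : SeminormedAddCommGroup E.PreTensor :=
  InnerProductSpace.Core.toSeminormedAddCommGroup (c := E.preTensorCore)
noncomputable instance : InnerProductSpace ℂ E.PreTensor :=
  InnerProductSpace.ofCore E.preTensorCore

theorem inner_preTmul (x y : E.carrier) (h k : H) :
    ⟪E.preTmul x h, E.preTmul y k⟫_ℂ = ⟪h, (E.inner x y : H →L[ℂ] H) k⟫_ℂ := rfl

/-- The interior tensor product of `E` and `H`: the Hilbert space obtained from the algebraic
tensor product by dividing out the vectors of length zero and completing. -/
abbrev Tensor : Type (max u v) := UniformSpace.Completion E.PreTensor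

/-- The operator `L_x : H → E ⊗ H`, `h ↦ x ⊗ h`. -/
noncomputable def creation (x : E.carrier) : H →L[ℂ] E.Tensor :=
  LinearMap.mkContinuous
    { toFun := fun h => (E.preTmul x h : E.Tensor)
      map_add' := fun h k => by
        rw [← UniformSpace.Completion.coe_add]
        exact congrArg _ (TensorProduct.tmul_add x h k)
      map_smul' := fun c h => by
        rw [RingHom.id_apply, ← UniformSpace.Completion.coe_smul]
        exact congrArg _ (TensorProduct.tmul_smul c x h) }
    ‖x‖ (fun h => by
      change ‖(E.preTmul x h : E.Tensor)‖ ≤ _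
      rw [UniformSpace.Completion.norm_coe]
      refine le_of_sq_le_sq ?_ (by positivity)
      rw [← inner_self_eq_norm_sq (𝕜 := ℂ), inner_preTmul, mul_pow, E.norm_sq_eq]
      refine (RCLike.re_le_norm _).trans ((norm_inner_le_norm _ _).trans ?_)
      calc ‖h‖ * ‖(E.inner x x : H →L[ℂ] H) h‖
          ≤ ‖h‖ * (‖(E.inner x x : H →L[ℂ] H)‖ * ‖h‖) := by
            gcongr; exact ContinuousLinearMap.le_opNorm _ _
        _ = ‖E.inner x x‖ * ‖h‖ ^ 2 := by
            change _ = ‖(E.inner x x : H →L[ℂ] H)‖ * ‖h‖ ^ 2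
            ring)

theorem creation_apply (x : E.carrier) (h : H) :
    E.creation x h = (E.preTmul x h : E.Tensor) := rfl

/-- `E` is a von Neumann module: `{L_x | x ∈ E}` is closed in `B(H, E ⊗ H)` for the strong operator
topology. -/
def IsVonNeumann : Prop :=
  IsClosed (Set.range fun x : E.carrier =>
    ContinuousLinearMap.toPointwiseConvergenceCLM ℂ (RingHom.id ℂ) H E.Tensor (E.creation x))

end HilbertModule

/-- A Hilbert `M`-`M`-bimodule (`C*`-correspondence from `M` to `M`): a Hilbert `M`-module with a
left action of `M` that is a unital `*`-homomorphism into the adjointable operators. -/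
structure HilbertBimodule (M : VonNeumannAlgebra H) extends HilbertModule.{u, v} M where
  [instLeft : Module (Elem M) carrier]
  [instLeftTower : IsScalarTower ℂ (Elem M) carrier]
  inner_left_smul : ∀ (b : Elem M) (x y : carrier), inner (b • x) y = inner x (star b • y)

attribute [instance] HilbertBimodule.instLeft HilbertBimodule.instLeftTower

variable {M : VonNeumannAlgebra H}

/-- A kernel over `Ω` from `M` to `M`, with values in the bounded linear maps. -/
abbrev Kernel (Ω : Type w) (M : VonNeumannAlgebra H) : Type (max u w) :=
  Ω → Ω → (Elem M →L[ℂ] Elem M)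

/-- Completely positive definite kernels. -/
def Kernel.IsCPD {Ω : Type w} (K : Kernel Ω M) : Prop :=
  ∀ (n : ℕ) (σ : Fin n → Ω) (b c : Fin n → Elem M),
    ((∑ i, ∑ j, star (c i) * K (σ i) (σ j) (star (b i) * b j) * c j : Elem M) :
      H →L[ℂ] H).IsPositive

/-- The kernel all of whose values are the identity map of `M`. -/
noncomputable def Kernel.identity (Ω : Type w) (M : VonNeumannAlgebra H) : Kernel Ω M :=
  fun _ _ => ContinuousLinearMap.id ℂ (Elem M)

/-- The set `S(E, K)` of all maps `i : Ω → E` with `K^{σ,σ'}(b) = ⟨i σ, b (i σ')⟩`. -/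
def HilbertBimodule.representing {Ω : Type w} (E : HilbertBimodule.{u, v} M) (K : Kernel Ω M) :
    Set (Ω → E.carrier) :=
  {i | ∀ (σ σ' : Ω) (b : Elem M), K σ σ' b = E.inner (i σ) (b • i σ')}

/-- `β_E(K₁, K₂)`, the infimum of all `‖i₁ σ - i₂ σ‖` with `σ ∈ Ω` and `i_m ∈ S(E, K_m)`;
the infimum of the empty set is `∞`. -/
noncomputable def buresOn {Ω : Type w} (E : HilbertBimodule.{u, v} M) (K₁ K₂ : Kernel Ω M) : ℝ≥0∞ :=
  ⨅ i₁ ∈ E.representing K₁, ⨅ i₂ ∈ E.representing K₂, ⨅ σ : Ω, ‖i₁ σ - i₂ σ‖ₑ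

/-- The Bures distance: the infimum of `β_E(K₁, K₂)` over all Hilbert bimodules `E` (with
`E` living in an arbitrary but fixed universe). -/
noncomputable def buresDist {Ω : Type w} (K₁ K₂ : Kernel Ω M) : ℝ≥0∞ :=
  ⨅ E : HilbertBimodule.{u, v} M, buresOn E K₁ K₂

/-- `(F, i)` is a (not necessarily minimal) Kolmogorov decomposition of `K`. -/
structure IsKolmogorovDecomposition {Ω : Type w} (K : Kernel Ω M) (F : HilbertBimodule.{u, v} M)
    (i : Ω → F.carrier) : Prop where
  isVonNeumann : F.toHilbertModule.IsVonNeumann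
  mem_representing : i ∈ F.representing K

/-- An isomorphism of Hilbert bimodules from `F` onto `M ⊕ F'`: the direct sum is `M × F'` with
componentwise left and right actions and with inner product
`⟨(a, x), (b, y)⟩ = a* b + ⟨x, y⟩`. -/
structure IsoSelfDirectSum (F F' : HilbertBimodule.{u, v} M) where
  toEquiv : F.carrier ≃ₗ[ℂ] Elem M × F'.carrier
  map_left : ∀ (b : Elem M) (x : F.carrier), toEquiv (b • x) = b • toEquiv x
  map_right : ∀ (b : Elem M) (x : F.carrier),
    toEquiv (MulOpposite.op b • x) = MulOpposite.op b • toEquiv x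
  inner_eq : ∀ x y : F.carrier, F.inner x y =
    star (toEquiv x).1 * (toEquiv y).1 + F'.inner (toEquiv x).2 (toEquiv y).2

end VNModule

/-! Since the distance is below 1, some bimodule `E` contains vectors `x = i₁ σ` and `y = i₂ σ`, for
a single index `σ`, with `‖x - y‖ < 1`; here `x` represents `K σ σ` and `⟨y, b y⟩ = b`. Expanding
`⟨b y - y b, b y - y b⟩` gives 0, so `y` is a central unit vector, and `⟨y, x⟩ = 1 - ⟨y, y - x⟩` is
invertible by the Neumann series.

This information has to be carried into `F`. The vector `f = i σ` induces the same map `b ↦ ⟨f, b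
f⟩` as `x`, so `b f c ↦ b x c` preserves inner products. Composing with `⟨y, ·⟩` gives a functional
on the bimodule generated by `f`. Because `F` is strongly closed, the functional is `⟨g, ·⟩` for
some `g` in the strong closure of that bimodule (`HilbertModule.exists_inner_eq`). This `g` is
central because `y` is, and `⟨g, f⟩ = ⟨y, x⟩` is invertible (`exists_isCentral_inner_eq`).

Then `z = ⟨g, g⟩` commutes with `M`, and positivity of `⟨g - s f', g - s f'⟩`, with `f'` a multiple
of `f` such that `⟨g, f'⟩ = 1`, bounds `z` below by a positive scalar. So `e = g z^(-1/2)` is a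
central unit vector (`IsCentral.exists_inner_self_eq_one`), and `F` is the sum of `e M`, a copy of
`M`, and the orthogonal complement of `e`, which is again a von Neumann bimodule
(`complement_isVonNeumann`). -/

namespace VNModule

/-! ### Bounded extensions and pointwise closures. -/

/-- If `‖C s‖ ≤ ‖A s‖` for all `s`, then `A s ↦ C s` extends to a bounded operator that vanishes on
the orthogonal complement of the range of `A`. -/
theorem exists_factor_of_norm_le {V K₁ K₂ : Type*} [AddCommGroup V] [Module ℂ V]
    [NormedAddCommGroup K₁] [InnerProductSpace ℂ K₁] [CompleteSpace K₁]
    [NormedAddCommGroup K₂] [InnerProductSpace ℂ K₂] [CompleteSpace K₂]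
    (A : V →ₗ[ℂ] K₁) (C : V →ₗ[ℂ] K₂) (h : ∀ s, ‖C s‖ ≤ ‖A s‖) :
    ∃ U : K₁ →L[ℂ] K₂, (∀ s, U (A s) = C s) ∧
      ∀ ξ, (∀ s, ⟪A s, ξ⟫_ℂ = 0) → U ξ = 0 := by
  let W := (LinearMap.range A).topologicalClosure
  have : CompleteSpace W := (Submodule.isClosed_topologicalClosure _).completeSpace_coe
  have hm : ∀ s, A s ∈ W := fun s =>
    Submodule.le_topologicalClosure _ (LinearMap.mem_range_self A s)
  let A' : V →ₗ[ℂ] W := A.codRestrict W hm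
  have hd : DenseRange A' := by
    rw [DenseRange, Subtype.dense_iff]
    rintro ξ hξ
    change ξ ∈ closure _ at hξ
    convert hξ
    ext η
    constructor
    · rintro ⟨_, ⟨s, rfl⟩, rfl⟩; exact ⟨s, rfl⟩
    · rintro ⟨s, rfl⟩; exact ⟨A' s, ⟨s, rfl⟩, rfl⟩
  refine ⟨(C.extendOfNorm A').comp W.orthogonalProjectionOnto, fun s => ?_, fun ξ hξ => ?_⟩
  · have : W.orthogonalProjectionOnto (A s) = A' s :=
      Submodule.orthogonalProjectionOnto_mem_subspace_eq_self (K := W) (A' s)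
    rw [ContinuousLinearMap.comp_apply, this]
    exact LinearMap.extendOfNorm_eq hd ⟨1, fun s => by rw [one_mul]; exact h s⟩ s
  · have : ξ ∈ Wᗮ := by
      rw [Submodule.orthogonal_closure]
      rintro _ ⟨s, rfl⟩
      exact hξ s
    rw [ContinuousLinearMap.comp_apply,
      Submodule.orthogonalProjectionOnto_eq_zero_iff.2 this, map_zero]

/-- Membership in the closure for the topology of pointwise convergence. -/
theorem mem_closure_range_pointwise_iff {H K X : Type*}
    [NormedAddCommGroup H] [NormedSpace ℂ H] [NormedAddCommGroup K] [NormedSpace ℂ K]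
    (L : X → H →L[ℂ] K) (S : H →L[ℂ] K) :
    ContinuousLinearMap.toPointwiseConvergenceCLM ℂ (RingHom.id ℂ) H K S ∈
      closure (Set.range fun x =>
        ContinuousLinearMap.toPointwiseConvergenceCLM ℂ (RingHom.id ℂ) H K (L x)) ↔
    ∀ (I : Finset H) (ε : ℝ), 0 < ε → ∃ x, ∀ h ∈ I, ‖S h - L x h‖ < ε := by
  have hind := (PointwiseConvergenceCLM.isEmbedding_coeFn (σ := RingHom.id ℂ) (E := H)
    (F := K)).isInducing
  rw [hind.closure_eq_preimage_closure_image, Set.mem_preimage, mem_closure_iff_nhds_basis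
    (nhds_pi (a := (S : H → K)) ▸ Filter.hasBasis_pi fun h => Metric.nhds_basis_ball (x := S h))]
  constructor
  · intro hS I ε hε
    obtain ⟨_, ⟨_, ⟨x, rfl⟩, rfl⟩, hx⟩ := hS (I, fun _ => ε) ⟨I.finite_toSet, fun _ _ => hε⟩
    refine ⟨x, fun h hh => ?_⟩
    rw [← dist_eq_norm, dist_comm]
    exact hx h hh
  · rintro hS ⟨I, r⟩ ⟨hI, hr⟩
    -- Only finitely many radii `r h` are involved, so one positive `ε` lies below all of them.
    have hev : ∀ᶠ ε in nhdsWithin (0 : ℝ) (Set.Ioi 0), ∀ h ∈ I, ε < r h :=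
      (Filter.eventually_all_finite hI).2 fun h hh =>
        nhdsWithin_le_nhds (Iio_mem_nhds (hr h hh))
    obtain ⟨ε, hε, hε0⟩ := (hev.and self_mem_nhdsWithin).exists
    obtain ⟨x, hx⟩ := hS hI.toFinset ε hε0
    refine ⟨_, ⟨_, ⟨x, rfl⟩, rfl⟩, fun h hh => ?_⟩
    rw [Metric.mem_ball, dist_comm, dist_eq_norm]
    exact (hx h (hI.mem_toFinset.2 hh)).trans (hε h hh)

/-! ### The operators `L_x` and the interior tensor product. -/

variable {H : Type u} [NormedAddCommGroup H] [InnerProductSpace ℂ H] [CompleteSpace H]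
variable {M : VonNeumannAlgebra H}

namespace HilbertModule

/-- The linear map `p ⊗ h ↦ φ p ⊗ h` into the interior tensor product. -/
noncomputable def tensorMap {Z : Type*} [AddCommGroup Z] [Module ℂ Z] (E : HilbertModule.{u, v} M)
    (φ : Z →ₗ[ℂ] E.carrier) : Z ⊗[ℂ] H →ₗ[ℂ] E.Tensor :=
  (UniformSpace.Completion.toComplL (𝕜 := ℂ) (E := E.PreTensor)).toLinearMap ∘ₗ
    (TensorProduct.map φ LinearMap.id : Z ⊗[ℂ] H →ₗ[ℂ] E.carrier ⊗[ℂ] H)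

theorem tensorMap_tmul {Z : Type*} [AddCommGroup Z] [Module ℂ Z] (E : HilbertModule.{u, v} M)
    (φ : Z →ₗ[ℂ] E.carrier) (p : Z) (h : H) : E.tensorMap φ (p ⊗ₜ h) = E.creation (φ p) h := rfl

theorem inner_creation (E : HilbertModule.{u, v} M) (x y : E.carrier) (h k : H) :
    ⟪E.creation x h, E.creation y k⟫_ℂ = ⟪h, (E.inner x y : H →L[ℂ] H) k⟫_ℂ := by
  rw [creation_apply, creation_apply, UniformSpace.Completion.inner_coe, inner_preTmul]

theorem norm_creation_le (E : HilbertModule.{u, v} M) (x : E.carrier) (h : H) :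
    ‖E.creation x h‖ ≤ ‖x‖ * ‖h‖ :=
  (E.creation x).le_of_opNorm_le (LinearMap.mkContinuous_norm_le _ (norm_nonneg _) _) h

theorem eq_of_forall_inner {a b : Elem M}
    (h : ∀ k l : H, ⟪k, (a : H →L[ℂ] H) l⟫_ℂ = ⟪k, (b : H →L[ℂ] H) l⟫_ℂ) : a = b :=
  Subtype.ext <| ContinuousLinearMap.ext fun l => ext_inner_left ℂ fun k => h k l

theorem creation_add (E : HilbertModule.{u, v} M) (x y : E.carrier) :
    E.creation (x + y) = E.creation x + E.creation y := by
  ext h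
  change E.tensorMap LinearMap.id ((x + y) ⊗ₜ h) = E.tensorMap LinearMap.id (x ⊗ₜ h) +
    E.tensorMap LinearMap.id (y ⊗ₜ h)
  rw [TensorProduct.add_tmul, map_add]

theorem creation_smul (E : HilbertModule.{u, v} M) (c : ℂ) (x : E.carrier) :
    E.creation (c • x) = c • E.creation x := by
  ext h
  change E.tensorMap LinearMap.id ((c • x) ⊗ₜ h) = c • E.tensorMap LinearMap.id (x ⊗ₜ h)
  rw [← map_smul]; rfl

/-- The linear map `x ↦ L_x`. -/
noncomputable def creationₗ (E : HilbertModule.{u, v} M) : E.carrier →ₗ[ℂ] H →L[ℂ] E.Tensor where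
  toFun := E.creation
  map_add' := E.creation_add
  map_smul' := E.creation_smul

theorem creation_sub (E : HilbertModule.{u, v} M) (x y : E.carrier) :
    E.creation (x - y) = E.creation x - E.creation y :=
  map_sub E.creationₗ x y

theorem creation_injective (E : HilbertModule.{u, v} M) {x y : E.carrier}
    (h : E.creation x = E.creation y) : x = y := by
  rw [← sub_eq_zero]
  refine E.inner_self_eq_zero _ (eq_of_forall_inner fun k l => ?_)
  rw [← inner_creation, creation_sub, h, sub_self]
  simp

/-- `(x b) ⊗ h = x ⊗ b h`. -/
theorem creation_op_smul (E : HilbertModule.{u, v} M) (b : Elem M) (x : E.carrier) (h : H) :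
    E.creation (MulOpposite.op b • x) h = E.creation x ((b : H →L[ℂ] H) h) := by
  -- The squared length of the difference expands into four terms that cancel once `b` is moved
  -- across the inner products.
  rw [← sub_eq_zero, ← _root_.inner_self_eq_zero (𝕜 := ℂ)]
  have hs : ∀ (k l : H), ⟪k, ((star b : Elem M) : H →L[ℂ] H) l⟫_ℂ = ⟪(b : H →L[ℂ] H) k, l⟫_ℂ := by
    intro k l
    change ⟪k, (star (b : H →L[ℂ] H)) l⟫_ℂ = _
    rw [ContinuousLinearMap.star_eq_adjoint, ContinuousLinearMap.adjoint_inner_right]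
  simp only [_root_.inner_sub_left, _root_.inner_sub_right, inner_creation, E.inner_mul_right,
    E.inner_mul_left]
  have hm : ∀ (c d : Elem M) (l : H), ((c * d : Elem M) : H →L[ℂ] H) l =
    (c : H →L[ℂ] H) ((d : H →L[ℂ] H) l) := fun c d l => rfl
  simp only [hm, hs]
  ring

theorem inner_tensorMap_eq {Z : Type*} [AddCommGroup Z] [Module ℂ Z]
    {E : HilbertModule.{u, v} M} {E' : HilbertModule.{u, t} M}
    (φ : Z →ₗ[ℂ] E.carrier) (ψ : Z →ₗ[ℂ] E'.carrier)
    (h : ∀ p q, E.inner (φ p) (φ q) = E'.inner (ψ p) (ψ q)) (s r : Z ⊗[ℂ] H) :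
    ⟪E.tensorMap φ s, E.tensorMap φ r⟫_ℂ = ⟪E'.tensorMap ψ s, E'.tensorMap ψ r⟫_ℂ := by
  induction s using TensorProduct.induction_on with
  | zero => simp
  | add s s' hs hs' => simp only [map_add, _root_.inner_add_left, hs, hs']
  | tmul p k =>
    induction r using TensorProduct.induction_on with
    | zero => simp
    | add r r' hr hr' => simp only [map_add, _root_.inner_add_right, hr, hr']
    | tmul q l => simp only [tensorMap_tmul, inner_creation, h]

theorem norm_tensorMap_eq {Z : Type*} [AddCommGroup Z] [Module ℂ Z]
    {E : HilbertModule.{u, v} M} {E' : HilbertModule.{u, t} M}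
    (φ : Z →ₗ[ℂ] E.carrier) (ψ : Z →ₗ[ℂ] E'.carrier)
    (h : ∀ p q, E.inner (φ p) (φ q) = E'.inner (ψ p) (ψ q)) (s : Z ⊗[ℂ] H) :
    ‖E.tensorMap φ s‖ = ‖E'.tensorMap ψ s‖ := by
  rw [norm_eq_sqrt_re_inner (𝕜 := ℂ), inner_tensorMap_eq φ ψ h, ← norm_eq_sqrt_re_inner]

/-- The vector `(x ⊗ h)_{h ∈ I}`, as a linear function of `x`. -/
noncomputable def creationPi (E : HilbertModule.{u, v} M) (I : Finset H) :
    E.carrier →ₗ[ℂ] PiLp 2 fun _ : I => E.Tensor :=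
  (WithLp.linearEquiv 2 ℂ (I → E.Tensor)).symm.toLinearMap ∘ₗ
    LinearMap.pi fun h : I => (ContinuousLinearMap.apply ℂ E.Tensor (h : H)).toLinearMap ∘ₗ
      E.creationₗ

theorem creationPi_apply (E : HilbertModule.{u, v} M) (I : Finset H) (x : E.carrier) (h : I) :
    E.creationPi I x h = E.creation x h := rfl

/-- The vector `(b h)_{h ∈ I}`, as a linear function of `b`. -/
noncomputable def evalPi (M : VonNeumannAlgebra H) (I : Finset H) :
    Elem M →ₗ[ℂ] PiLp 2 fun _ : I => H where
  toFun b := WithLp.toLp 2 fun h => (b : H →L[ℂ] H) h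
  map_add' _ _ := rfl
  map_smul' _ _ := rfl

theorem evalPi_apply (I : Finset H) (b : Elem M) (h : I) :
    evalPi M I b h = (b : H →L[ℂ] H) h := rfl

/-! ### Representing functionals by vectors of a von Neumann module. -/

/-- An operator `S` from `H` into the closed linear span of `X ⊗ H` such that `L_x* S ∈ M` for all
`x` in the right submodule `X` is a strong limit of operators `L_x` with `x ∈ X`. -/
theorem exists_norm_sub_creation_lt (F : HilbertModule.{u, v} M) (X : Submodule ℂ F.carrier)
    (hX : ∀ x ∈ X, ∀ b : Elem M, MulOpposite.op b • x ∈ X) (S : H →L[ℂ] F.Tensor)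
    (hS : ∀ ξ, (∀ x ∈ X, ∀ k, ⟪F.creation x k, ξ⟫_ℂ = 0) → ∀ h, ⟪S h, ξ⟫_ℂ = 0)
    (hM : ∀ x ∈ X, ∃ b : Elem M, ∀ h k, ⟪F.creation x k, S h⟫_ℂ = ⟪k, (b : H →L[ℂ] H) h⟫_ℂ)
    (I : Finset H) (ε : ℝ) (hε : 0 < ε) :
    ∃ x ∈ X, ∀ h ∈ I, ‖S h - F.creation x h‖ < ε := by
  -- Amplification as in the double commutant theorem: approximating `S` at all `h ∈ I` at once
  -- means approximating one vector `s` of a finite direct sum. Its component `q` orthogonal to `N`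
  -- is to vanish.
  let N := (X.map (F.creationPi I)).topologicalClosure
  let N₀ := (LinearMap.range (evalPi M I)).topologicalClosure
  have : CompleteSpace N := (Submodule.isClosed_topologicalClosure _).completeSpace_coe
  let s : PiLp 2 fun _ : I => F.Tensor := WithLp.toLp 2 fun h => S h
  obtain ⟨p, hp, q, hq, hpq⟩ := N.exists_add_mem_mem_orthogonal s
  have hq' : ∀ y ∈ X, ⟪F.creationPi I y, q⟫_ℂ = 0 := fun y hy =>
    hq _ (Submodule.le_topologicalClosure _ ⟨y, hy, rfl⟩)
  have hadj : ∀ x ∈ X, ∀ h : I, ContinuousLinearMap.adjoint (F.creation x) (q h) = 0 := by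
    intro x hx
    -- `D` applies `L_x*` in each coordinate. Both `D p` and `D s` lie in `N₀`, since `L_x* L_y =
    -- ⟨x, y⟩` and `L_x* S` belong to `M`; hence so does `D q`.
    let D : (PiLp 2 fun _ : I => F.Tensor) → PiLp 2 fun _ : I => H := fun r =>
      WithLp.toLp 2 fun h => ContinuousLinearMap.adjoint (F.creation x) (r h)
    have hD : Continuous D := by fun_prop
    have h1 : D p ∈ N₀ := by
      refine map_mem_closure hD hp ?_
      rintro _ ⟨y, -, rfl⟩
      refine ⟨F.inner x y, ?_⟩
      ext h
      refine ext_inner_left ℂ fun k => ?_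
      rw [evalPi_apply]
      change _ = ⟪k, ContinuousLinearMap.adjoint (F.creation x) (F.creation y h)⟫_ℂ
      rw [ContinuousLinearMap.adjoint_inner_right, inner_creation]
    have h2 : D s ∈ N₀ := by
      obtain ⟨b, hb⟩ := hM x hx
      refine Submodule.le_topologicalClosure _ ⟨b, ?_⟩
      ext h
      refine ext_inner_left ℂ fun k => ?_
      change _ = ⟪k, ContinuousLinearMap.adjoint (F.creation x) (S h)⟫_ℂ
      rw [ContinuousLinearMap.adjoint_inner_right, hb, evalPi_apply]
    have h3 : D q ∈ N₀ := by
      have : D q = D s - D p := by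
        ext h
        simp [D, hpq]
      rw [this]
      exact N₀.sub_mem h2 h1
    -- Moving `L_x` back turns `(b h)` into `(x b ⊗ h)`, which is orthogonal to `q` because `X` is a
    -- right submodule.
    have h4 : D q ∈ N₀ᗮ := by
      rw [Submodule.orthogonal_closure]
      rintro _ ⟨b, rfl⟩
      rw [← hq' _ (hX x hx b), PiLp.inner_apply, PiLp.inner_apply]
      refine Finset.sum_congr rfl fun h _ => ?_
      change ⟪(b : H →L[ℂ] H) h, ContinuousLinearMap.adjoint (F.creation x) (q h)⟫_ℂ = _
      rw [ContinuousLinearMap.adjoint_inner_right, creationPi_apply, creation_op_smul]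
    have h5 : D q = 0 := (_root_.inner_self_eq_zero (𝕜 := ℂ)).1 (h4 _ h3)
    intro h
    exact congrArg (fun r : PiLp 2 fun _ : I => H => r h) h5
  -- Each coordinate of `q` is now orthogonal to `X ⊗ H`, hence to the values of `S`. So `q` is
  -- orthogonal to both `s` and `p`, and thus to `q = s - p`.
  have hq0 : q = 0 := by
    have hX0 : ∀ x ∈ X, ∀ (h : I) k, ⟪F.creation x k, q h⟫_ℂ = 0 := fun x hx h k => by
      rw [← ContinuousLinearMap.adjoint_inner_right, hadj x hx, _root_.inner_zero_right]
    have hsq : ⟪s, q⟫_ℂ = 0 := by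
      rw [PiLp.inner_apply]
      exact Finset.sum_eq_zero fun h _ => hS _ (fun x hx => hX0 x hx h) h
    have hpq0 : ⟪p, q⟫_ℂ = 0 := hq p hp
    rw [hpq, _root_.inner_add_left, hpq0, zero_add] at hsq
    exact (_root_.inner_self_eq_zero (𝕜 := ℂ)).1 hsq
  have hsN : s ∈ N := by rwa [hpq, hq0, add_zero]
  obtain ⟨_, ⟨x, hx, rfl⟩, hxs⟩ := Metric.mem_closure_iff.1 hsN ε hε
  refine ⟨x, hx, fun h hh => ?_⟩
  rw [dist_eq_norm] at hxs
  exact (PiLp.norm_apply_le (s - F.creationPi I x) ⟨h, hh⟩).trans_lt hxs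

/-- Let `Z ⊆ F × E` be a right submodule whose two coordinates have the same inner products, with
`F` a von Neumann module. Then for `y ∈ E` the map `p.1 ↦ ⟨y, p.2⟩` is given by an element `g` of
`F` in the strong closure of the first coordinates. -/
theorem exists_inner_eq {F : HilbertModule.{u, v} M} {E : HilbertModule.{u, t} M}
    (hF : F.IsVonNeumann) (Z : Submodule ℂ (F.carrier × E.carrier))
    (hZ : ∀ p ∈ Z, ∀ q ∈ Z, F.inner p.1 q.1 = E.inner p.2 q.2)
    (hZr : ∀ p ∈ Z, ∀ b : Elem M, (MulOpposite.op b • p.1, MulOpposite.op b • p.2) ∈ Z)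
    (y : E.carrier) :
    ∃ g : F.carrier, (∀ p ∈ Z, F.inner g p.1 = E.inner y p.2) ∧
      ∀ (h : H) (ε : ℝ), 0 < ε → ∃ p ∈ Z, ‖F.creation (g - p.1) h‖ < ε := by
  let φ : Z →ₗ[ℂ] F.carrier := LinearMap.fst ℂ _ _ ∘ₗ Z.subtype
  let ψ : Z →ₗ[ℂ] E.carrier := LinearMap.snd ℂ _ _ ∘ₗ Z.subtype
  -- `U` sends `p.1 ⊗ h` to `p.2 ⊗ h`. The desired `g` must satisfy `L_g* = L_y* U` on the first
  -- coordinates, so the candidate for `L_g` is `S = U* L_y`.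
  obtain ⟨U, hU, hU0⟩ := exists_factor_of_norm_le (F.tensorMap φ) (E.tensorMap ψ) fun s =>
    (norm_tensorMap_eq φ ψ (fun p q => hZ p p.2 q q.2) s).ge
  let S : H →L[ℂ] F.Tensor := (ContinuousLinearMap.adjoint U).comp (E.creation y)
  have hSi : ∀ h ξ, ⟪S h, ξ⟫_ℂ = ⟪E.creation y h, U ξ⟫_ℂ := fun h ξ =>
    ContinuousLinearMap.adjoint_inner_left U ξ _
  have hUc : ∀ p ∈ Z, ∀ k, U (F.creation p.1 k) = E.creation p.2 k := fun p hp k =>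
    hU ((⟨p, hp⟩ : Z) ⊗ₜ k)
  have happ := F.exists_norm_sub_creation_lt (Z.map (LinearMap.fst ℂ _ _))
    (by
      rintro _ ⟨p, hp, rfl⟩ b
      exact ⟨_, hZr p hp b, rfl⟩)
    S
    (by
      intro ξ hξ h
      rw [hSi, hU0 ξ fun s => ?_, _root_.inner_zero_right]
      induction s using TensorProduct.induction_on with
      | zero => simp
      | add s r hs hr => rw [map_add, _root_.inner_add_left, hs, hr, add_zero]
      | tmul p k => exact hξ _ ⟨p, p.2, rfl⟩ k)
    (by
      rintro _ ⟨p, hp, rfl⟩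
      refine ⟨E.inner p.2 y, fun h k => ?_⟩
      rw [← inner_conj_symm, hSi]
      erw [hUc p hp]
      rw [inner_conj_symm, inner_creation])
  have hmem : ContinuousLinearMap.toPointwiseConvergenceCLM ℂ (RingHom.id ℂ) H F.Tensor S ∈
      Set.range fun x : F.carrier =>
        ContinuousLinearMap.toPointwiseConvergenceCLM ℂ (RingHom.id ℂ) H F.Tensor
          (F.creation x) := by
    rw [← IsClosed.closure_eq hF, mem_closure_range_pointwise_iff]
    intro I ε hε
    obtain ⟨x, -, hx⟩ := happ I ε hε
    exact ⟨x, hx⟩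
  obtain ⟨g, hg⟩ := hmem
  have hgS : F.creation g = S := ContinuousLinearMap.ext fun h => DFunLike.congr_fun hg h
  refine ⟨g, fun p hp => eq_of_forall_inner fun k l => ?_, fun h ε hε => ?_⟩
  · rw [← inner_creation, ← inner_creation, hgS, hSi, hUc p hp]
  · obtain ⟨_, ⟨p, hp, rfl⟩, hx⟩ := happ {h} ε hε
    refine ⟨p, hp, ?_⟩
    rw [creation_sub, hgS]
    exact hx h (Finset.mem_singleton_self h)

end HilbertModule

/-! ### Positivity and inverse square roots in C*-algebras. -/

theorem exists_star_mul_self_eq_norm_sq_sub {C : Type*} [CStarAlgebra C] (b : C) :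
    ∃ c : C, star c * c = ((‖b‖ ^ 2 : ℝ) : ℂ) • 1 - star b * b := by
  let _ : PartialOrder C := CStarAlgebra.spectralOrder _
  have _ : StarOrderedRing C := CStarAlgebra.spectralOrderedRing _
  obtain ⟨c, hc⟩ := CStarAlgebra.nonneg_iff_eq_star_mul_self.1
    (sub_nonneg.2 (CStarAlgebra.star_mul_le_algebraMap_norm_sq (a := b)))
  exact ⟨c, by rw [← hc, Algebra.algebraMap_eq_smul_one, Complex.coe_smul]⟩

/-- A form of `z ^ (-1/2)` for those `z` for which `z - 2 s + s² q` is positive for all real `s`. -/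
theorem exists_star_mul_mul_eq_one {C : Type*} [CStarAlgebra C] (z q : C) (hq : IsSelfAdjoint q)
    (h : ∀ s : ℝ, ∃ R : C, z - (2 * s) • 1 + s ^ 2 • q = star R * R) :
    ∃ w : C, star w * z * w = 1 ∧ ∀ b, Commute z b → Commute w b := by
  rcases subsingleton_or_nontrivial C with _ | _
  · exact ⟨1, Subsingleton.elim _ _, fun b _ => Commute.one_left b⟩
  let _ : PartialOrder C := CStarAlgebra.spectralOrder _
  have _ : StarOrderedRing C := CStarAlgebra.spectralOrderedRing _
  -- This `s` gives `s² q ≤ s² ‖q‖ ≤ s`, whence `z ≥ 2 s - s² q ≥ s > 0`.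
  set s : ℝ := (‖q‖ + 1)⁻¹ with hs
  have hs0 : 0 < s := by positivity
  have hsq : s ^ 2 * ‖q‖ ≤ s := by
    have : s * (‖q‖ + 1) = 1 := inv_mul_cancel₀ (by positivity)
    nlinarith
  obtain ⟨R, hR⟩ := h s
  have h0 : 0 ≤ z - (2 * s) • 1 + s ^ 2 • q := hR ▸ star_mul_self_nonneg R
  have hq1 : q ≤ ‖q‖ • 1 := by
    rw [← Algebra.algebraMap_eq_smul_one]
    exact hq.le_algebraMap_norm_self
  have h1 : s ^ 2 • q ≤ s • 1 := by
    refine (smul_le_smul_of_nonneg_left hq1 (by positivity)).trans ?_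
    rw [smul_smul]
    exact smul_le_smul_of_nonneg_right hsq zero_le_one
  have hz : algebraMap ℝ C s ≤ z := by
    have h2 : (2 * s) • (1 : C) - s ^ 2 • q ≤ z := by
      rw [← sub_nonneg]
      convert h0 using 1
      abel
    refine le_trans ?_ h2
    rw [Algebra.algebraMap_eq_smul_one, le_sub_comm, ← sub_smul]
    convert h1 using 2
    ring
  have hzp : IsStrictlyPositive z := by
    refine IsStrictlyPositive.of_le ?_ hz
    exact IsStrictlyPositive.iff_of_unital.2 ⟨by
      rw [Algebra.algebraMap_eq_smul_one]
      exact smul_nonneg hs0.le zero_le_one, (isUnit_iff_ne_zero.2 hs0.ne').map _⟩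
  refine ⟨z ^ (-(1 / 2) : ℝ), ?_, fun b hb => ?_⟩
  · rw [(IsSelfAdjoint.of_nonneg (CFC.rpow_nonneg (a := z))).star_eq]
    exact CFC.conjugate_rpow_neg_one_half z
  · rw [CFC.rpow_def]
    exact hb.cfc_nnreal _

/-! ### Cauchy–Schwarz and positivity for Hilbert modules. -/

namespace HilbertModule

theorem inner_sub_right (E : HilbertModule.{u, v} M) (x y z : E.carrier) :
    E.inner x (y - z) = E.inner x y - E.inner x z :=
  map_sub (AddMonoidHom.mk' (E.inner x) (E.inner_add_right x)) y z

theorem inner_sub_left (E : HilbertModule.{u, v} M) (x y z : E.carrier) :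
    E.inner (x - y) z = E.inner x z - E.inner y z :=
  map_sub (AddMonoidHom.mk' (fun x => E.inner x z) (fun x y => E.inner_add_left x y z)) x y

/-- The Cauchy–Schwarz inequality. -/
theorem norm_inner_le (E : HilbertModule.{u, v} M) (x y : E.carrier) :
    ‖E.inner x y‖ ≤ ‖x‖ * ‖y‖ := by
  refine ContinuousLinearMap.opNorm_le_bound (E.inner x y : H →L[ℂ] H) (by positivity) fun k => ?_
  -- Testing against `c` itself reduces the claim to the scalar Cauchy–Schwarz inequality in `E ⊗
  -- H`.
  set c := (E.inner x y : H →L[ℂ] H) k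
  rcases eq_or_ne c 0 with hc | hc
  · rw [hc, norm_zero]
    positivity
  refine le_of_mul_le_mul_left ?_ (norm_pos_iff.2 hc)
  calc ‖c‖ * ‖c‖ = ‖⟪c, c⟫_ℂ‖ := by
        rw [inner_self_eq_norm_sq_to_K, norm_pow, RCLike.norm_ofReal, abs_norm, pow_two]
    _ = ‖⟪E.creation x c, E.creation y k⟫_ℂ‖ := by rw [inner_creation]
    _ ≤ ‖E.creation x c‖ * ‖E.creation y k‖ := norm_inner_le_norm _ _
    _ ≤ (‖x‖ * ‖c‖) * (‖y‖ * ‖k‖) := by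
        gcongr <;> exact E.norm_creation_le _ _
    _ = ‖c‖ * (‖x‖ * ‖y‖ * ‖k‖) := by ring

/-- The elements `⟨x, x⟩` are positive in the C*-algebra `M`. -/
theorem exists_inner_self_eq (E : HilbertModule.{u, v} M) (x : E.carrier) :
    ∃ R : Elem M, E.inner x x = star R * R := by
  -- Positivity is given for operators on `H` but is needed inside `M`. The compression of `⟨x, x⟩`
  -- by `X` is `⟨x X, x X⟩`, a positive operator; being also `-(S X)*(S X)`, it forces `S X = 0`.
  refine nonneg_of_forall_compression _ (E.star_inner x x) fun X S hX _ h => ?_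
  have h1 : E.inner (MulOpposite.op X • x) (MulOpposite.op X • x) =
      -(star (S * X) * (S * X)) := by
    rw [E.inner_mul_left, E.inner_mul_right, hX.star_eq, ← mul_assoc, h]
  refine Subtype.ext (ContinuousLinearMap.ext fun k => ?_)
  have h2 := (E.inner_self_nonneg (MulOpposite.op X • x)).re_inner_nonneg_right k
  rw [h1] at h2
  change 0 ≤ RCLike.re ⟪k, (-(star ((S * X : Elem M) : H →L[ℂ] H) *
    ((S * X : Elem M) : H →L[ℂ] H))) k⟫_ℂ at h2
  rw [neg_apply, _root_.inner_neg_right, mul_apply_eq_comp,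
    ContinuousLinearMap.star_eq_adjoint, ContinuousLinearMap.adjoint_inner_right, map_neg,
    inner_self_eq_norm_sq] at h2
  change ((S * X : Elem M) : H →L[ℂ] H) k = 0
  rw [← norm_eq_zero]
  nlinarith [norm_nonneg (((S * X : Elem M) : H →L[ℂ] H) k)]

theorem ext_inner_self (E : HilbertModule.{u, v} M) {x y : E.carrier}
    (h : ∀ z, E.inner z x = E.inner z y) : x = y := by
  rw [← sub_eq_zero]
  refine E.inner_self_eq_zero _ ?_
  rw [inner_sub_right, h, sub_self]

end HilbertModule

/-! ### Central vectors and their transport between bimodules. -/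

namespace HilbertBimodule

/-- The left and the right action commute. -/
theorem smul_op_smul (E : HilbertBimodule.{u, v} M) (b c : Elem M) (x : E.carrier) :
    b • MulOpposite.op c • x = MulOpposite.op c • b • x := by
  -- Adjointable maps are automatically right linear: moving `b` to the other side of the inner
  -- product frees the right factor `c`.
  refine E.ext_inner_self fun z => ?_
  have hl : ∀ (w : E.carrier), E.inner z (b • w) = E.inner (star b • z) w := fun w => by
    rw [E.inner_left_smul, star_star]
  rw [hl, E.inner_mul_right, E.inner_mul_right, hl]

theorem inner_smul_smul (E : HilbertBimodule.{u, v} M) (b c : Elem M) (x y : E.carrier) :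
    E.inner (b • x) (c • y) = E.inner x ((star b * c) • y) := by
  rw [E.inner_left_smul, mul_smul]

/-- The left action is bounded on elementary tensors. -/
theorem norm_creation_smul_le (E : HilbertBimodule.{u, v} M) (b : Elem M) (x : E.carrier) (h : H) :
    ‖E.creation (b • x) h‖ ≤ ‖b‖ * ‖E.creation x h‖ := by
  obtain ⟨c, hc⟩ := exists_star_mul_self_eq_norm_sq_sub b
  have hre : ∀ z : E.carrier, ((‖E.creation z h‖ ^ 2 : ℝ) : ℂ) =
      ⟪h, (E.inner z z : H →L[ℂ] H) h⟫_ℂ := by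
    intro z
    rw [← HilbertModule.inner_creation, inner_self_eq_norm_sq_to_K]
    norm_cast
  -- With `c* c = ‖b‖² - b* b`, the defect in the desired inequality is exactly the squared length
  -- of `c x ⊗ h`.
  have h1 : E.inner (c • x) (c • x) =
      ((‖b‖ ^ 2 : ℝ) : ℂ) • E.inner x x - E.inner (b • x) (b • x) := by
    rw [inner_smul_smul, hc, sub_smul, HilbertModule.inner_sub_right, inner_smul_smul,
      ← E.inner_smul_right]
    rw [smul_assoc, one_smul]
  have h2 : ‖E.creation (c • x) h‖ ^ 2 =
      ‖b‖ ^ 2 * ‖E.creation x h‖ ^ 2 - ‖E.creation (b • x) h‖ ^ 2 := by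
    have : ((‖E.creation (c • x) h‖ ^ 2 : ℝ) : ℂ) =
        ((‖b‖ ^ 2 * ‖E.creation x h‖ ^ 2 - ‖E.creation (b • x) h‖ ^ 2 : ℝ) : ℂ) := by
      rw [Complex.ofReal_sub, Complex.ofReal_mul, hre, hre, hre, h1]
      change ⟪h, ((_ : ℂ) • (E.inner x x : H →L[ℂ] H) -
        (E.inner (b • x) (b • x) : H →L[ℂ] H)) h⟫_ℂ = _
      simp
    exact_mod_cast this
  refine le_of_sq_le_sq ?_ (by positivity)
  nlinarith [sq_nonneg ‖E.creation (c • x) h‖]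

/-- `x` commutes with `M`. -/
def IsCentral (E : HilbertBimodule.{u, v} M) (x : E.carrier) : Prop :=
  ∀ b : Elem M, b • x = MulOpposite.op b • x

/-- In `⟨b y - y b, b y - y b⟩` each of the four terms equals `b* b` up to sign, so they cancel. -/
theorem isCentral_of_inner_smul (E : HilbertBimodule.{u, v} M) {y : E.carrier}
    (hy : ∀ b : Elem M, E.inner y (b • y) = b) : E.IsCentral y := by
  have h1 : E.inner y y = 1 := by simpa using hy 1
  have hl : ∀ (b : Elem M) (z : E.carrier), E.inner (b • y) z = E.inner y (star b • z) :=
    fun b z => E.inner_left_smul b y z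
  intro b
  rw [← sub_eq_zero]
  refine E.inner_self_eq_zero _ ?_
  simp only [HilbertModule.inner_sub_left, HilbertModule.inner_sub_right, E.inner_mul_left,
    E.inner_mul_right, hl, ← mul_smul, hy, h1]
  simp

variable {F : HilbertBimodule.{u, v} M} {E : HilbertBimodule.{u, t} M}

/-- The span of all pairs `(b f c, b x c)`. -/
def pairs (f : F.carrier) (x : E.carrier) : Submodule ℂ (F.carrier × E.carrier) :=
  Submodule.span ℂ (Set.range fun b : Elem M × Elem M =>
    (b.1 • MulOpposite.op b.2 • f, b.1 • MulOpposite.op b.2 • x))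

theorem mem_pairs (f : F.carrier) (x : E.carrier) : (f, x) ∈ pairs f x :=
  Submodule.subset_span ⟨(1, 1), by simp⟩

theorem smul_mem_pairs {f : F.carrier} {x : E.carrier} {p : F.carrier × E.carrier}
    (hp : p ∈ pairs f x) (b : Elem M) : (b • p.1, b • p.2) ∈ pairs f x := by
  induction hp using Submodule.span_induction with
  | mem _ h =>
    obtain ⟨c, rfl⟩ := h
    exact Submodule.subset_span ⟨(b * c.1, c.2), by simp only [mul_smul]⟩
  | zero => simp only [Prod.fst_zero, Prod.snd_zero, smul_zero]; exact (pairs f x).zero_mem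
  | add p q _ _ hp hq => simpa [smul_add] using (pairs f x).add_mem hp hq
  | smul a p _ hp => simpa [smul_comm b a] using (pairs f x).smul_mem a hp

theorem op_smul_mem_pairs {f : F.carrier} {x : E.carrier} {p : F.carrier × E.carrier}
    (hp : p ∈ pairs f x) (b : Elem M) :
    (MulOpposite.op b • p.1, MulOpposite.op b • p.2) ∈ pairs f x := by
  induction hp using Submodule.span_induction with
  | mem _ h =>
    obtain ⟨c, rfl⟩ := h
    exact Submodule.subset_span ⟨(c.1, c.2 * b), by
      simp only [MulOpposite.op_mul, mul_smul, smul_op_smul]⟩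
  | zero => simp only [Prod.fst_zero, Prod.snd_zero, smul_zero]; exact (pairs f x).zero_mem
  | add p q _ _ hp hq => simpa [smul_add] using (pairs f x).add_mem hp hq
  | smul a p _ hp => simpa [smul_comm (MulOpposite.op b) a] using (pairs f x).smul_mem a hp

/-- On generators both sides are `c* ⟨·, b* b' ·⟩ c'`, which depends only on the induced map. Thus
`pairs f x` is the graph of the isometry `b f c ↦ b x c`, and well-definedness of that map never has
to be checked separately. -/
theorem inner_pairs {f : F.carrier} {x : E.carrier}
    (h : ∀ b : Elem M, F.inner f (b • f) = E.inner x (b • x))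
    {p q : F.carrier × E.carrier} (hp : p ∈ pairs f x) (hq : q ∈ pairs f x) :
    F.inner p.1 q.1 = E.inner p.2 q.2 := by
  induction hp, hq using Submodule.span_induction₂ with
  | mem_mem _ _ h1 h2 =>
    obtain ⟨c, rfl⟩ := h1
    obtain ⟨d, rfl⟩ := h2
    simp only [inner_smul_smul]
    simp only [smul_op_smul, F.inner_mul_left, F.inner_mul_right, E.inner_mul_left,
      E.inner_mul_right, h]
  | zero_left q _ => simp [HilbertModule.inner_zero_left]
  | zero_right q _ => simp [HilbertModule.inner_zero_right]
  | add_left p p' q _ _ _ h1 h2 => simp [HilbertModule.inner_add_left, h1, h2]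
  | add_right p q q' _ _ _ h1 h2 => simp [HilbertModule.inner_add_right, h1, h2]
  | smul_left c p q _ _ h1 => simp [HilbertModule.inner_smul_left, h1]
  | smul_right c p q _ _ h1 => simp [HilbertModule.inner_smul_right, h1]

/-- If `f ∈ F` and `x ∈ E` induce the same completely positive map and `y ∈ E` is central, then
there is a central `g` in the von Neumann bimodule `F` with `⟨g, f⟩ = ⟨y, x⟩`. -/
theorem exists_isCentral_inner_eq (hF : F.toHilbertModule.IsVonNeumann) {f : F.carrier}
    {x y : E.carrier} (h : ∀ b : Elem M, F.inner f (b • f) = E.inner x (b • x))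
    (hy : E.IsCentral y) : ∃ g : F.carrier, F.IsCentral g ∧ F.inner g f = E.inner y x := by
  obtain ⟨g, hg, happ⟩ := HilbertModule.exists_inner_eq hF (pairs f x)
    (fun p hp q hq => inner_pairs h hp hq) (fun p hp b => op_smul_mem_pairs hp b) y
  refine ⟨g, fun b => ?_, hg _ (mem_pairs f x)⟩
  -- Centrality of `g`: the vector `b g - g b` is orthogonal to the bimodule generated by `f`, yet
  -- lies in its strong closure (`hdh`), so it is zero.
  have hdp : ∀ p ∈ pairs f x, F.inner (b • g - MulOpposite.op b • g) p.1 = 0 := by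
    intro p hp
    rw [HilbertModule.inner_sub_left, F.inner_left_smul, F.inner_mul_left,
      hg _ (smul_mem_pairs hp (star b)), hg _ hp, ← E.inner_left_smul, hy b, E.inner_mul_left,
      sub_self]
  have hdh : ∀ (k : H) (ε : ℝ), 0 < ε → ∃ p ∈ pairs f x, ∃ q ∈ pairs f x,
      ‖F.creation (b • g - MulOpposite.op b • g) k -
        (F.creation p.1 k - F.creation q.1 k)‖ < ε := by
    intro k ε hε
    obtain ⟨p, hp, hpε⟩ := happ k (ε / 2 / (‖b‖ + 1)) (by positivity)
    -- The second approximation is taken at `b k` because `g b ⊗ k = g ⊗ b k`; it may use a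
    -- different pair, as only one vector `k` is considered at a time.
    obtain ⟨q, hq, hqε⟩ := happ ((b : H →L[ℂ] H) k) (ε / 2) (by positivity)
    refine ⟨_, smul_mem_pairs hp b, _, op_smul_mem_pairs hq b, ?_⟩
    have e : F.creation (b • g - MulOpposite.op b • g) k -
        (F.creation (b • p.1) k - F.creation (MulOpposite.op b • q.1) k) =
        F.creation (b • (g - p.1)) k - F.creation (g - q.1) ((b : H →L[ℂ] H) k) := by
      simp only [smul_sub, HilbertModule.creation_sub, sub_apply, HilbertModule.creation_op_smul]
      abel
    rw [e]
    refine (norm_sub_le _ _).trans_lt ?_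
    have h1 := F.norm_creation_smul_le b (g - p.1) k
    have h2 : ‖b‖ * ‖F.creation (g - p.1) k‖ ≤ ε / 2 := by
      rw [lt_div_iff₀ (by positivity)] at hpε
      nlinarith [norm_nonneg (F.creation (g - p.1) k)]
    linarith
  rw [← sub_eq_zero]
  apply F.creation_injective
  ext k
  refine sub_eq_zero.1 (norm_eq_zero.1 ?_)
  set d := b • g - MulOpposite.op b • g
  have hd0 : F.creation (0 : F.carrier) k = 0 := by
    have := F.creationₗ.map_zero
    exact DFunLike.congr_fun this k
  rw [hd0, sub_zero]
  refine le_antisymm (le_of_forall_pos_lt_add fun ε hε => ?_) (norm_nonneg _)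
  obtain ⟨p, hp, q, hq, hpq⟩ := hdh k ε hε
  rw [zero_add]
  refine lt_of_le_of_lt ?_ hpq
  -- By Pythagoras, the distance from `d ⊗ k` to a vector orthogonal to it is at least its own
  -- length.
  have horth : ⟪F.creation d k, F.creation p.1 k - F.creation q.1 k⟫_ℂ = 0 := by
    rw [_root_.inner_sub_right, HilbertModule.inner_creation, HilbertModule.inner_creation,
      hdp p hp, hdp q hq]
    simp
  have := norm_sub_sq (𝕜 := ℂ) (F.creation d k) (F.creation p.1 k - F.creation q.1 k)
  rw [horth] at this
  refine le_of_sq_le_sq ?_ (norm_nonneg _)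
  rw [this]
  simp

end HilbertBimodule

/-! ### Normalizing a central vector and splitting it off. -/

namespace HilbertModule

theorem denseRange_tensorMap_id (E : HilbertModule.{u, v} M) :
    DenseRange (E.tensorMap LinearMap.id) := by
  have h : ∀ s : E.PreTensor, E.tensorMap LinearMap.id s = (s : E.Tensor) := fun s =>
    congrArg (fun t : E.PreTensor => (t : E.Tensor))
      (LinearMap.congr_fun (TensorProduct.map_id (R := ℂ) (M := E.carrier) (N := H)) s)
  refine Dense.mono ?_ (UniformSpace.Completion.denseRange_coe (α := E.PreTensor))
  rintro _ ⟨s, rfl⟩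
  exact ⟨s, h s⟩

end HilbertModule

namespace HilbertBimodule

/-- The element `⟨g, b g⟩` is computed in two ways: replacing `b g` by `g b`, and moving `b*` to the
left entry. -/
theorem IsCentral.commute_inner_self {F : HilbertBimodule.{u, v} M} {g : F.carrier}
    (hg : F.IsCentral g) (b : Elem M) : Commute (F.inner g g) b := by
  have h1 : F.inner g (b • g) = F.inner g g * b := by rw [hg b, F.inner_mul_right]
  have h2 : F.inner g (b • g) = b * F.inner g g := by
    rw [← star_star b, ← F.inner_left_smul, hg, F.inner_mul_left]
  exact h1.symm.trans h2

/-- A central vector with an invertible inner product can be normalized. -/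
theorem IsCentral.exists_inner_self_eq_one {F : HilbertBimodule.{u, v} M} {g f : F.carrier}
    (hg : F.IsCentral g) (hgf : IsUnit (F.inner g f)) :
    ∃ e : F.carrier, F.IsCentral e ∧ F.inner e e = 1 := by
  obtain ⟨a, ha⟩ := hgf
  let f' := MulOpposite.op (↑a⁻¹ : Elem M) • f
  have h1 : F.inner g f' = 1 := by rw [F.inner_mul_right, ← ha, Units.mul_inv]
  have h2 : F.inner f' g = 1 := by rw [← F.star_inner, h1, star_one]
  -- Since `⟨g, f'⟩ = 1`, the positive element `⟨g - s f', g - s f'⟩` is `z - 2 s + s² q` with `z =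
  -- ⟨g, g⟩` and `q = ⟨f', f'⟩`.
  obtain ⟨w, hw, hwc⟩ := exists_star_mul_mul_eq_one (F.inner g g) (F.inner f' f')
    (F.star_inner f' f') fun s => by
      obtain ⟨R, hR⟩ := F.exists_inner_self_eq (g - (s : ℂ) • f')
      refine ⟨R, ?_⟩
      rw [← hR]
      simp only [HilbertModule.inner_sub_left, HilbertModule.inner_sub_right,
        F.inner_smul_left, F.inner_smul_right, h1, h2, RCLike.star_def, Complex.conj_ofReal]
      simp only [Complex.coe_smul, two_mul, add_smul, pow_two, mul_smul, smul_sub]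
      abel
  -- The vector `g w` stays central because `w` commutes with everything that commutes with `⟨g,
  -- g⟩`, that is, with all of `M`.
  refine ⟨MulOpposite.op w • g, fun b => ?_, ?_⟩
  · rw [smul_op_smul, hg b, smul_smul, smul_smul, ← MulOpposite.op_mul, ← MulOpposite.op_mul,
      (hwc b (hg.commute_inner_self b)).eq]
  · rw [F.inner_mul_left, F.inner_mul_right, ← mul_assoc, hw]

/-- The orthogonal complement of a vector, as a subspace. -/
def perp (F : HilbertBimodule.{u, v} M) (g : F.carrier) : Submodule ℂ F.carrier where
  carrier := {x | F.inner g x = 0}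
  add_mem' {x y} hx hy := by
    rw [Set.mem_ofPred_eq] at *
    rw [F.inner_add_right, hx, hy, add_zero]
  zero_mem' := F.inner_zero_right g
  smul_mem' c x hx := by
    rw [Set.mem_ofPred_eq] at *
    rw [F.inner_smul_right, hx, smul_zero]

theorem mem_perp {F : HilbertBimodule.{u, v} M} {g x : F.carrier} :
    x ∈ F.perp g ↔ F.inner g x = 0 := Iff.rfl

theorem isClosed_perp (F : HilbertBimodule.{u, v} M) (g : F.carrier) :
    IsClosed (F.perp g : Set F.carrier) := by
  let T : F.carrier →L[ℂ] Elem M := LinearMap.mkContinuous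
    { toFun := F.inner g
      map_add' := F.inner_add_right g
      map_smul' := fun c x => F.inner_smul_right g x c } ‖g‖ (F.norm_inner_le g)
  exact isClosed_singleton.preimage T.continuous

/-- The orthogonal complement of a central vector is a Hilbert bimodule. -/
noncomputable def complement (F : HilbertBimodule.{u, v} M) (g : F.carrier) (hg : F.IsCentral g) :
    HilbertBimodule.{u, v} M :=
  have hr : ∀ (b : (Elem M)ᵐᵒᵖ) (x : F.perp g), b • (x : F.carrier) ∈ F.perp g := fun b x => by
    rw [mem_perp, ← MulOpposite.op_unop b, F.inner_mul_right, mem_perp.1 x.2, zero_mul]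
  -- Left invariance is where centrality enters: `⟨g, b x⟩ = ⟨b* g, x⟩ = ⟨g b*, x⟩ = b ⟨g, x⟩`.
  have hl : ∀ (b : Elem M) (x : F.perp g), b • (x : F.carrier) ∈ F.perp g := fun b x => by
    rw [mem_perp, ← star_star b, ← F.inner_left_smul, hg, F.inner_mul_left, mem_perp.1 x.2,
      mul_zero]
  letI : SMul (Elem M)ᵐᵒᵖ (F.perp g) := ⟨fun b x => ⟨b • (x : F.carrier), hr b x⟩⟩
  letI : SMul (Elem M) (F.perp g) := ⟨fun b x => ⟨b • (x : F.carrier), hl b x⟩⟩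
  letI : Module (Elem M)ᵐᵒᵖ (F.perp g) :=
    Function.Injective.module _ (F.perp g).subtype.toAddMonoidHom Subtype.val_injective
      fun _ _ => rfl
  letI : Module (Elem M) (F.perp g) :=
    Function.Injective.module _ (F.perp g).subtype.toAddMonoidHom Subtype.val_injective
      fun _ _ => rfl
  haveI : CompleteSpace (F.perp g) := (F.isClosed_perp g).completeSpace_coe
  haveI : IsScalarTower ℂ (Elem M)ᵐᵒᵖ (F.perp g) :=
    ⟨fun c b x => Subtype.ext (smul_assoc c b (x : F.carrier))⟩
  haveI : IsScalarTower ℂ (Elem M) (F.perp g) :=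
    ⟨fun c b x => Subtype.ext (smul_assoc c b (x : F.carrier))⟩
  { carrier := F.perp g
    inner := fun x y => F.inner x y
    inner_add_right := fun x y z => F.inner_add_right x y z
    inner_smul_right := fun x y c => F.inner_smul_right x y c
    inner_mul_right := fun x y b => F.inner_mul_right x y b
    star_inner := fun x y => F.star_inner x y
    inner_self_nonneg := fun x => F.inner_self_nonneg x
    inner_self_eq_zero := fun x hx => Subtype.ext (F.inner_self_eq_zero x hx)
    norm_sq_eq := fun x => F.norm_sq_eq x
    inner_left_smul := fun b x y => F.inner_left_smul b x y }

variable (F : HilbertBimodule.{u, v} M) (g : F.carrier) (hg : F.IsCentral g)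

/-- The inclusion of the orthogonal complement. -/
noncomputable def complementIncl : (F.complement g hg).carrier →ₗ[ℂ] F.carrier :=
  (F.perp g).subtype

/-- The inclusion induces an isometry `J` from the tensor product of the complement into that of
`F`. It carries a strong limit `S` of operators `L_z` to a strong limit in `F`, which is some `L_x`.
Orthogonality to `g` passes to the limit, so `x` lies in the complement, and the left inverse `J'`
of `J` recovers `S`. -/
theorem complement_isVonNeumann (hF : F.toHilbertModule.IsVonNeumann) :
    (F.complement g hg).toHilbertModule.IsVonNeumann := by
  set F' := F.complement g hg
  let φ : F'.carrier →ₗ[ℂ] F.carrier := F.complementIncl g hg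
  have hφ : ∀ p q, F.inner (φ p) (φ q) = F'.inner p q := fun _ _ => rfl
  obtain ⟨J, hJ, -⟩ := exists_factor_of_norm_le (F'.tensorMap LinearMap.id) (F.tensorMap φ)
    fun s => (HilbertModule.norm_tensorMap_eq φ LinearMap.id hφ s).le
  obtain ⟨J', hJ', -⟩ := exists_factor_of_norm_le (F.tensorMap φ) (F'.tensorMap LinearMap.id)
    fun s => (HilbertModule.norm_tensorMap_eq φ LinearMap.id hφ s).ge
  have hJc : ∀ x k, J (F'.creation x k) = F.creation (φ x) k := fun x k => hJ (x ⊗ₜ k)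
  have hJc' : ∀ x k, J' (F.creation (φ x) k) = F'.creation x k := fun x k => hJ' (x ⊗ₜ k)
  have hJJ : ∀ ξ, J' (J ξ) = ξ := fun ξ =>
    congrFun (F'.denseRange_tensorMap_id.equalizer (g := fun ξ => J' (J ξ)) (h := id)
      (by fun_prop) continuous_id
      (funext fun s => by simp only [Function.comp_apply, id_eq, hJ, hJ'])) ξ
  refine isClosed_of_closure_subset fun S' hS' => ?_
  obtain ⟨S, rfl⟩ : ∃ S : H →L[ℂ] F'.Tensor,
    ContinuousLinearMap.toPointwiseConvergenceCLM ℂ (RingHom.id ℂ) H F'.Tensor S = S' := ⟨S', rfl⟩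
  rw [mem_closure_range_pointwise_iff] at hS'
  have happ : ∀ (I : Finset H) (ε : ℝ), 0 < ε → ∃ x : F'.carrier, ∀ h ∈ I,
      ‖J.comp S h - F.creation (φ x) h‖ < ε := by
    intro I ε hε
    obtain ⟨x, hx⟩ := hS' I (ε / (‖J‖ + 1)) (by positivity)
    refine ⟨x, fun h hh => ?_⟩
    rw [← hJc, ContinuousLinearMap.comp_apply, ← map_sub]
    refine (J.le_opNorm _).trans_lt ?_
    have := hx h hh
    rw [lt_div_iff₀ (by positivity)] at this
    nlinarith [norm_nonneg (S h - F'.creation x h)]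
  have hmem : ContinuousLinearMap.toPointwiseConvergenceCLM ℂ (RingHom.id ℂ) H F.Tensor
      (J.comp S) ∈ Set.range fun x : F.carrier =>
        ContinuousLinearMap.toPointwiseConvergenceCLM ℂ (RingHom.id ℂ) H F.Tensor
          (F.creation x) := by
    rw [← IsClosed.closure_eq hF, mem_closure_range_pointwise_iff]
    intro I ε hε
    obtain ⟨x, hx⟩ := happ I ε hε
    exact ⟨φ x, hx⟩
  obtain ⟨x, hx⟩ := hmem
  have hxS : ∀ k, F.creation x k = J (S k) := fun k => DFunLike.congr_fun hx k
  have hx0 : F.inner g x = 0 := by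
    refine HilbertModule.eq_of_forall_inner fun h k => ?_
    rw [← HilbertModule.inner_creation, hxS]
    have h0 : ∀ z : F'.carrier, ⟪F.creation g h, F.creation (φ z) k⟫_ℂ = 0 := fun z => by
      have hz : F.inner g (φ z) = 0 := mem_perp.1 z.2
      rw [HilbertModule.inner_creation, hz]
      simp
    have h1 : ‖⟪F.creation g h, J (S k)⟫_ℂ‖ ≤ 0 := by
      refine le_of_forall_pos_lt_add fun ε hε => ?_
      obtain ⟨z, hz⟩ := happ {k} (ε / (‖F.creation g h‖ + 1)) (by positivity)
      have h2 := hz k (Finset.mem_singleton_self k)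
      have h3 : ⟪F.creation g h, J (S k)⟫_ℂ =
          ⟪F.creation g h, J (S k) - F.creation (φ z) k⟫_ℂ := by
        rw [_root_.inner_sub_right, h0, sub_zero]
      rw [h3, zero_add]
      refine (norm_inner_le_norm _ _).trans_lt ?_
      rw [lt_div_iff₀ (by positivity)] at h2
      rw [ContinuousLinearMap.comp_apply] at h2
      nlinarith [norm_nonneg (J (S k) - F.creation (φ z) k)]
    rw [norm_le_zero_iff.1 h1]
    simp
  let x' : F'.carrier := (⟨x, hx0⟩ : F.perp g)
  have hx' : φ x' = x := rfl
  refine ⟨x', DFunLike.ext _ _ fun k => ?_⟩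
  change F'.creation x' k = S k
  rw [← hJc', hx', hxS, hJJ]

/-- `F` is the direct sum of `M` and the orthogonal complement of a central unit vector. -/
noncomputable def isoSelfDirectSum (h1 : F.inner g g = 1) :
    IsoSelfDirectSum F (F.complement g hg) where
  toEquiv :=
    { toFun := fun x => (F.inner g x, (⟨x - MulOpposite.op (F.inner g x) • g, by
        rw [mem_perp, HilbertModule.inner_sub_right, F.inner_mul_right, h1, one_mul,
          sub_self]⟩ : F.perp g))
      map_add' := fun x y => Prod.ext (F.inner_add_right g x y) <| Subtype.ext <| by
        change x + y - _ = (x - _) + (y - _)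
        rw [F.inner_add_right, MulOpposite.op_add, add_smul]
        abel
      map_smul' := fun c x => Prod.ext (F.inner_smul_right g x c) <| Subtype.ext <| by
        change c • x - _ = c • (x - _)
        rw [F.inner_smul_right, MulOpposite.op_smul, smul_assoc, smul_sub]
      invFun := fun p => MulOpposite.op p.1 • g + F.complementIncl g hg p.2
      left_inv := fun x => add_sub_cancel _ x
      right_inv := fun p => by
        have h : F.inner g (MulOpposite.op p.1 • g + F.complementIncl g hg p.2) = p.1 := by
          have : F.inner g (F.complementIncl g hg p.2) = 0 := mem_perp.1 p.2.2
          rw [F.inner_add_right, F.inner_mul_right, h1, one_mul, this, add_zero]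
        refine Prod.ext h (Subtype.ext ?_)
        change _ + _ - MulOpposite.op (F.inner g _) • g = F.complementIncl g hg p.2
        rw [h, add_sub_cancel_left] }
  map_left b x := by
    have h : F.inner g (b • x) = b * F.inner g x := by
      rw [← star_star b, ← F.inner_left_smul, hg, F.inner_mul_left]
    refine Prod.ext h (Subtype.ext ?_)
    change b • x - MulOpposite.op (F.inner g (b • x)) • g = b • (x - _)
    rw [h, smul_sub, smul_op_smul, hg b, smul_smul, ← MulOpposite.op_mul]
  map_right b x := by
    refine Prod.ext (F.inner_mul_right g x b) (Subtype.ext ?_)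
    change MulOpposite.op b • x - MulOpposite.op (F.inner g (MulOpposite.op b • x)) • g =
      MulOpposite.op b • (x - _)
    rw [F.inner_mul_right, smul_sub, smul_smul, ← MulOpposite.op_mul]
  inner_eq x y := by
    change F.inner x y = star (F.inner g x) * F.inner g y +
      F.inner (x - MulOpposite.op (F.inner g x) • g) (y - MulOpposite.op (F.inner g y) • g)
    simp only [HilbertModule.inner_sub_left, HilbertModule.inner_sub_right, F.inner_mul_left,
      F.inner_mul_right, h1, F.star_inner, mul_one, sub_self, zero_mul]
    abel

end HilbertBimodule

end VNModule

/-! ### The main theorem. -/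

theorem mainTheorem4 {H : Type u} [NormedAddCommGroup H] [InnerProductSpace ℂ H] [CompleteSpace H]
    (B : VonNeumannAlgebra H) {Ω : Type w} (K : VNModule.Kernel Ω B) (hK : K.IsCPD)
    (F : VNModule.HilbertBimodule.{u, v} B) (i : Ω → F.carrier)
    (hF : VNModule.IsKolmogorovDecomposition K F i)
    (hβ : VNModule.buresDist.{u, w, t} K (VNModule.Kernel.identity Ω B) < 1) :
    ∃ F' : VNModule.HilbertBimodule.{u, v} B,
      F'.toHilbertModule.IsVonNeumann ∧ Nonempty (VNModule.IsoSelfDirectSum F F') := by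
  simp only [VNModule.buresDist, VNModule.buresOn, iInf_lt_iff] at hβ
  obtain ⟨E, i₁, h₁, i₂, h₂, σ, hσ⟩ := hβ
  have hy : ∀ b : VNModule.Elem B, E.inner (i₂ σ) (b • i₂ σ) = b := fun b => (h₂ σ σ b).symm
  obtain ⟨g, hg, hgf⟩ := VNModule.HilbertBimodule.exists_isCentral_inner_eq hF.isVonNeumann
    (fun b => (hF.mem_representing σ σ b).symm.trans (h₁ σ σ b)) (E.isCentral_of_inner_smul hy)
  have hyy : E.inner (i₂ σ) (i₂ σ) = 1 := by simpa using hy 1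
  have hnorm : ‖i₂ σ‖ ≤ 1 := by
    -- The zero algebra is treated apart, since there the unit has norm 0 rather than 1.
    rcases subsingleton_or_nontrivial (VNModule.Elem B) with _ | _
    · have := E.norm_sq_eq (i₂ σ)
      rw [Subsingleton.elim (E.inner _ _) 0, norm_zero] at this
      nlinarith [norm_nonneg (i₂ σ)]
    · have := E.norm_sq_eq (i₂ σ)
      rw [hyy, CStarRing.norm_one] at this
      nlinarith [norm_nonneg (i₂ σ)]
  have hlt : ‖i₁ σ - i₂ σ‖ < 1 := by
    rwa [← ofReal_norm, ← ENNReal.ofReal_one, ENNReal.ofReal_lt_ofReal_iff one_pos] at hσ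
  have hunit : IsUnit (F.inner g (i σ)) := by
    rw [hgf]
    -- The subtracted term has norm at most `‖i₂ σ‖ ‖i₂ σ - i₁ σ‖ < 1`, so the Neumann series
    -- applies.
    have h1 : E.inner (i₂ σ) (i₁ σ) = 1 - E.inner (i₂ σ) (i₂ σ - i₁ σ) := by
      rw [VNModule.HilbertModule.inner_sub_right, hyy, sub_sub_cancel]
    rw [h1]
    refine isUnit_one_sub_of_norm_lt_one ((E.norm_inner_le _ _).trans_lt ?_)
    rw [norm_sub_rev]
    nlinarith [norm_nonneg (i₁ σ - i₂ σ)]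
  obtain ⟨e, he, he1⟩ := hg.exists_inner_self_eq_one hunit
  exact ⟨F.complement e he, F.complement_isVonNeumann e he hF.isVonNeumann,
    ⟨F.isoSelfDirectSum e he he1⟩⟩
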